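/- Consider a game with agents $i\in\{1,\dots,N\}$, decision sets $X_i\subseteq\mathbb{R}^n$, stacked decision vector $x=(x_i,x_{-i})\in\mathbb{R}^{nN}$, deterministic costs $f_i(x_i,x_{-i})\in\mathbb{R}$ that are convex in $x_i$ for every $x_{-i}\in\prod_{j\ne i}X_j$, and uncertain costs $$g_i(x_i,x_{-i},\xi_i)=\xi_i^\top Q_i\xi_i+P_i(x)^\top\xi_i,\qquad P_i(x)=A_ix+b_i,\quad \xi_i\in\mathbb{R}^m,$$ where $A_i\in\mathbb{R}^{m\times nN}$, $b_i\in\mathbb{R}^m$ and $Q_i=L_i^\top D_iL_i$ with $L_i$ orthogonal and $D_i$ diagonal, positive semidefinite, with sorted diagonal entries. For each agent fix a radius $\varepsilon_i\ge 0$ and samples $\xi_i^{(1)},\dots,\xi_i^{(K_i)}\in\mathbb{R}^m$, $K_i\ge 1$, let $\hat{\mathbb{P}}_{K_i}=\frac1{K_i}\sum_{k=1}^{K_i}\delta_{\xi_i^{(k)}}$, and let $\mathcal{P}_i$ be the set of all probability measures $\mathbb{Q}$ on $\mathbb{R}^m$ with $W_2(\mathbb{Q},\hat{\mathbb{P}}_{K_i})\le\varepsilon_i$,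 where $W_2(\mathbb{Q}_1,\mathbb{Q}_2)=\bigl(\inf_\Pi\int\|\xi_1-\xi_2\|^2\,\Pi(d\xi_1,d\xi_2)\bigr)^{1/2}$ is the type-2 Wasserstein distance for the Euclidean norm ($\Pi$ ranges over the couplings of $\mathbb{Q}_1$ and $\mathbb{Q}_2$). For $\lambda_i\ge 0$ put $$J_i(x_i,\lambda_i,x_{-i})=f_i(x_i,x_{-i})+\lambda_i\varepsilon_i^2+\frac1{K_i}\sum_{k=1}^{K_i}\sup_{\xi\in\mathbb{R}^m}\Bigl[\xi^\top Q_i\xi+P_i(x)^\top\xi-\lambda_i\|\xi-\xi_i^{(k)}\|^2\Bigr]\in(-\infty,+\infty].$$ Then for every agent $i$ and all decisions $x_{-i}$ of the other agents: 1. for every $x_i\in\mathbb{R}^n$, $g_i(x_i,x_{-i},\cdot)$ is integrable under every $\mathbb{Q}\in\mathcal{P}_i$, and $$\max_{\mathbb{Q}\in\mathcal{P}_i}\bigl\{f_i(x_i,x_{-i})+\mathbb{E}_{\xi\sim\mathbb{Q}}[g_i(x_i,x_{-i},\xi)]\bigr\}=\inf_{\lambda_i\ge 0}J_i(x_i,\lambda_i,x_{-i}),$$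 where the maximum is attained, and the infimum is attained (is a minimum) if $\varepsilon_i>0$; 2. consequently agent $i$'s distributionally robust problem has the same optimal value as its problem in the augmented game $\bar G$: $$\inf_{x_i\in X_i}\max_{\mathbb{Q}\in\mathcal{P}_i}\bigl\{f_i(x_i,x_{-i})+\mathbb{E}_{\xi\sim\mathbb{Q}}[g_i(x_i,x_{-i},\xi)]\bigr\}=\inf_{x_i\in X_i,\ \lambda_i\ge 0}J_i(x_i,\lambda_i,x_{-i}),$$ and, if $\varepsilon_i>0$, $x_i\in X_i$ minimizes the left-hand problem if and only if $(x_i,\lambda_i)$ minimizes the right-hand problem for some $\lambda_i\ge 0$. -/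

import Mathlib

open MeasureTheory Set
open scoped ENNReal Matrix

noncomputable section

/-- Couplings of `μ` and `ν`: joint laws with marginals `μ` and `ν`. -/
def couplings {m : ℕ} (μ ν : Measure (EuclideanSpace ℝ (Fin m))) :
    Set (Measure (EuclideanSpace ℝ (Fin m) × EuclideanSpace ℝ (Fin m))) :=
  {π | π.fst = μ ∧ π.snd = ν}

/-- The type-2 Wasserstein distance for the Euclidean norm,
`(inf_π ∫ ‖ξ₁ - ξ₂‖² dπ)^{1/2}`, with values in `[0, ∞]`. -/
def wasserstein2 {m : ℕ} (μ ν : Measure (EuclideanSpace ℝ (Fin m))) : ℝ≥0∞ :=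
  (⨅ π ∈ couplings μ ν, ∫⁻ z, ‖z.1 - z.2‖ₑ ^ 2 ∂π) ^ (1 / 2 : ℝ)

/-- The empirical distribution `(1/K) ∑ₖ δ_{s k}` of a sample `s`. -/
def empirical {m K : ℕ} (s : Fin K → EuclideanSpace ℝ (Fin m)) :
    Measure (EuclideanSpace ℝ (Fin m)) :=
  (K : ℝ≥0∞)⁻¹ • ∑ k, Measure.dirac (s k)

/-- The data of the game: `N` agents with decisions in `ℝⁿ` and uncertain parameters in `ℝᵐ`.
A strategy profile is a map `Fin N → ℝⁿ`; profiles are `(x_i, x_{-i})`. -/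
structure DRGame (N n m : ℕ) where
  /-- Local decision sets. -/
  X : Fin N → Set (EuclideanSpace ℝ (Fin n))
  /-- Deterministic costs. -/
  f : Fin N → (Fin N → EuclideanSpace ℝ (Fin n)) → ℝ
  /-- Uncertain costs. -/
  g : Fin N → (Fin N → EuclideanSpace ℝ (Fin n)) → EuclideanSpace ℝ (Fin m) → ℝ
  /-- Numbers of samples. -/
  K : Fin N → ℕ
  /-- Samples. -/
  sample : (i : Fin N) → Fin (K i) → EuclideanSpace ℝ (Fin m)
  /-- Radii of the ambiguity balls. -/
  ε : Fin N → ℝ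

/-- The affine map `P(x) = A x + b`, where `x = col(x_1, …, x_N)` is the stacked decision vector. -/
def affineP {N n m : ℕ} (A : Matrix (Fin m) (Fin N × Fin n) ℝ) (b : Fin m → ℝ)
    (x : Fin N → EuclideanSpace ℝ (Fin n)) : Fin m → ℝ :=
  A *ᵥ (fun p => x p.1 p.2) + b

/-- The quadratic-bilinear cost `ξᵀ Q ξ + P(x) ξ` with `P(x) = A x + b`. -/
def quadBilin {N n m : ℕ} (Q : Matrix (Fin m) (Fin m) ℝ)
    (A : Matrix (Fin m) (Fin N × Fin n) ℝ) (b : Fin m → ℝ)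
    (x : Fin N → EuclideanSpace ℝ (Fin n)) (ξ : EuclideanSpace ℝ (Fin m)) : ℝ :=
  ξ.ofLp ⬝ᵥ (Q *ᵥ ξ.ofLp) + affineP A b x ⬝ᵥ ξ.ofLp

namespace DRGame

variable {N n m : ℕ} (G : DRGame N n m)

/-- The structural assumption on the costs: `f_i` is convex in `x_i`; `g_i` is
quadratic-bilinear with `P_i` affine; and `Q_i = L_iᵀ D_i L_i` with `L_i` orthogonal and `D_i`
diagonal, positive semidefinite, with sorted diagonal. -/
structure CostAssumption (Q : Fin N → Matrix (Fin m) (Fin m) ℝ)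
    (A : Fin N → Matrix (Fin m) (Fin N × Fin n) ℝ) (b : Fin N → Fin m → ℝ) : Prop where
  convex : ∀ (i : Fin N) (x : Fin N → EuclideanSpace ℝ (Fin n)), (∀ j, j ≠ i → x j ∈ G.X j) →
    ConvexOn ℝ univ (fun y => G.f i (Function.update x i y))
  form : ∀ i x ξ, G.g i x ξ = quadBilin (Q i) (A i) (b i) x ξ
  spectral : ∀ i, ∃ L ∈ Matrix.orthogonalGroup (Fin m) ℝ, ∃ d : Fin m → ℝ,
    (∀ j, 0 ≤ d j) ∧ Antitone d ∧ Q i = Lᵀ * Matrix.diagonal d * L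

/-- The Wasserstein ambiguity ball of agent `i` around its empirical distribution. -/
def ball (i : Fin N) : Set (Measure (EuclideanSpace ℝ (Fin m))) :=
  {μ | IsProbabilityMeasure μ ∧
    wasserstein2 μ (empirical (G.sample i)) ≤ ENNReal.ofReal (G.ε i)}

/-- The cost `f_i(x) + 𝔼_μ[g_i(x, ξ)]` of agent `i` under the distribution `μ`. -/
def expCost (i : Fin N) (x : Fin N → EuclideanSpace ℝ (Fin n))
    (μ : Measure (EuclideanSpace ℝ (Fin m))) : ℝ :=
  G.f i x + ∫ ξ, G.g i x ξ ∂μ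

/-- The worst-case cost of agent `i` over its ambiguity ball. -/
def worstCost (i : Fin N) (x : Fin N → EuclideanSpace ℝ (Fin n)) : EReal :=
  ⨆ μ ∈ G.ball i, (G.expCost i x μ : EReal)

/-- The dual objective `J_i(x_i, l, x_{-i})`, which may be `+∞`. -/
def dualCost (Q : Fin N → Matrix (Fin m) (Fin m) ℝ)
    (A : Fin N → Matrix (Fin m) (Fin N × Fin n) ℝ) (b : Fin N → Fin m → ℝ)
    (i : Fin N) (x : Fin N → EuclideanSpace ℝ (Fin n)) (l : ℝ) : EReal :=
  ((G.f i x + l * G.ε i ^ 2 : ℝ) : EReal) + ((1 / (G.K i : ℝ) : ℝ) : EReal) *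
    ∑ k, ⨆ ξ : EuclideanSpace ℝ (Fin m),
      ((quadBilin (Q i) (A i) (b i) x ξ - l * ‖ξ - G.sample i k‖ ^ 2 : ℝ) : EReal)

end DRGame

end

/-! Weak duality: integrating h(ξ) ≤ l‖ξ - ζ‖² + sup_η [h(η) - l‖η - ζ‖²] against nearly optimal
couplings bounds every expectation over the ball by the dual value
(`integral_le_of_wasserstein2_le`).

For the converse, empirical measures with moved atoms suffice. Choosing K atoms with total squared
displacement at most Kε² means maximizing a convex quadratic over a ball in (ℝᵐ)^K. This is not a
concave problem, yet it has no duality gap: comparing a maximizer on the sphere with its reflections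
in hyperplanes yields both stationarity and the curvature bound T ≤ l (`exists_multiplier_ball`).
Given l, the Lagrangian splits over the samples (`exists_multiplier_sum`), so the moved atoms attain
the inner suprema, and complementary slackness equates the two values.

For ε = 0 a multiplier may fail to exist; the same result on balls of radius r → 0, with continuity
in the atoms, still gives the infimum. The second claim follows by taking the infimum over the own
decision. -/

/-! ### Convex quadratics on balls: Lagrange multipliers -/

/-- Non-strict inequalities between continuous functions extend from an open half space to its
closure. -/
theorem le_of_forall_inner_pos {E : Type*} [NormedAddCommGroup E] [InnerProductSpace ℝ E]
    {u : E} (hu : u ≠ 0) {φ ψ : E → ℝ} (hφ : Continuous φ) (hψ : Continuous ψ)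
    (h : ∀ w, 0 < inner ℝ u w → φ w ≤ ψ w) (w : E) (hw : 0 ≤ inner ℝ u w) : φ w ≤ ψ w := by
  have key : ∀ χ : E → ℝ, Continuous χ →
      Filter.Tendsto (fun t : ℝ => χ (w + t • u)) (nhdsWithin 0 (Ioi 0)) (nhds (χ w)) := by
    intro χ hχ
    have : Continuous fun t : ℝ => χ (w + t • u) := by fun_prop
    simpa using (this.tendsto 0).mono_left nhdsWithin_le_nhds
  refine le_of_tendsto_of_tendsto (key φ hφ) (key ψ hψ) ?_
  filter_upwards [self_mem_nhdsWithin] with t ht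
  apply h
  rw [inner_add_right, inner_smul_right]
  have : 0 < t * inner ℝ u u := mul_pos ht (real_inner_self_pos.2 hu)
  linarith

/-- Strong duality for the maximization of a convex quadratic function over a ball: a maximizer
over the sphere has a nonnegative Lagrange multiplier for which it is a global maximizer of the
Lagrangian. -/
theorem exists_multiplier_ball {E : Type*} [NormedAddCommGroup E] [InnerProductSpace ℝ E]
    [FiniteDimensional ℝ E] (T : E →L[ℝ] E) (hT : ∀ w, 0 ≤ inner ℝ w (T w)) (p : E) {r : ℝ}
    (hr : 0 < r) :
    ∃ l : ℝ, 0 ≤ l ∧ ∃ u : E, ‖u‖ ≤ r ∧ l * (r ^ 2 - ‖u‖ ^ 2) = 0 ∧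
      ∀ v, inner ℝ v (T v) + inner ℝ p v - l * ‖v‖ ^ 2 ≤
        inner ℝ u (T u) + inner ℝ p u - l * ‖u‖ ^ 2 := by
  -- In the zero space the sphere of radius `r` is empty.
  rcases subsingleton_or_nontrivial E with hE | hE
  · refine ⟨0, le_rfl, 0, by simpa using hr.le, by simp, fun v => ?_⟩
    rw [Subsingleton.elim v 0]
  obtain ⟨u, hu, hmax⟩ := (isCompact_sphere (0 : E) r).exists_isMaxOn
    (NormedSpace.sphere_nonempty.2 hr.le)
    (f := fun v => inner ℝ v (T v) + inner ℝ p v) (by fun_prop)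
  have hur : ‖u‖ = r := by simpa using hu
  have hu0 : u ≠ 0 := by
    rintro rfl
    simp at hur
    exact hr.ne hur
  -- The gradient of the objective at `u`; `T` need not be symmetric.
  set e : E := ContinuousLinearMap.adjoint T u + T u + p with he
  have expand : ∀ w, inner ℝ (u + w) (T (u + w)) + inner ℝ p (u + w) =
      inner ℝ u (T u) + inner ℝ p u + inner ℝ e w + inner ℝ w (T w) := by
    intro w
    simp only [he, map_add, inner_add_left, inner_add_right,
      ContinuousLinearMap.adjoint_inner_left]
    rw [real_inner_comm (T u) w]
    ring
  have hsq : ∀ w, ‖u + w‖ ^ 2 = ‖u‖ ^ 2 + 2 * inner ℝ u w + ‖w‖ ^ 2 := fun w =>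
    norm_add_sq_real u w
  have refl : ∀ w, 0 < inner ℝ u w → 2 * inner ℝ u w * inner ℝ w (T w) ≤ ‖w‖ ^ 2 * inner ℝ e w := by
    intro w hw
    have hw0 : 0 < ‖w‖ ^ 2 := by
      have : w ≠ 0 := by
        rintro rfl
        simp at hw
      positivity
    set a := inner ℝ u w
    -- `u + t • w` is the reflection of `u` in the hyperplane orthogonal to `w`, so it stays on the
    -- sphere.
    set t := -(2 * a / ‖w‖ ^ 2) with ht
    have hmem : u + t • w ∈ Metric.sphere (0 : E) r := by
      have h1 := hsq (t • w)
      have h2 : 2 * inner ℝ u (t • w) + ‖t • w‖ ^ 2 = 0 := by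
        rw [inner_smul_right, norm_smul, mul_pow, Real.norm_eq_abs, sq_abs]
        change 2 * (t * a) + _ = 0
        rw [ht]
        field_simp
        ring
      rw [mem_sphere_zero_iff_norm, ← hur]
      exact (sq_eq_sq₀ (norm_nonneg _) (norm_nonneg _)).1 (by linarith)
    have h3 := hmax hmem
    simp only [mem_ofPred_eq] at h3
    rw [expand, map_smul, inner_smul_right, inner_smul_left, inner_smul_right] at h3
    simp only [conj_trivial] at h3
    have h4 : t * (inner ℝ e w + t * inner ℝ w (T w)) ≤ 0 := by nlinarith
    have ht0 : t < 0 := by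
      rw [ht]
      have : 0 < 2 * a / ‖w‖ ^ 2 := by positivity
      linarith
    have h5 : 0 ≤ inner ℝ e w + t * inner ℝ w (T w) := by
      by_contra hcon
      push Not at hcon
      exact absurd h4 (not_le.2 (mul_pos_of_neg_of_neg ht0 hcon))
    have h6 : ‖w‖ ^ 2 * t = -(2 * a) := by
      rw [ht, mul_neg, mul_div_cancel₀ _ hw0.ne']
    have h7 := mul_nonneg hw0.le h5
    have h8 : ‖w‖ ^ 2 * (inner ℝ e w + t * inner ℝ w (T w)) =
        ‖w‖ ^ 2 * inner ℝ e w - 2 * a * inner ℝ w (T w) := by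
      linear_combination inner ℝ w (T w) * h6
    linarith
  have refl' := le_of_forall_inner_pos hu0 (φ := fun w => 2 * inner ℝ u w * inner ℝ w (T w))
    (ψ := fun w => ‖w‖ ^ 2 * inner ℝ e w) (by fun_prop) (by fun_prop) refl
  have orth_nonneg : ∀ w, inner ℝ u w = 0 → 0 ≤ inner ℝ e w := by
    intro w hw
    rcases eq_or_ne w 0 with rfl | hw0
    · simp
    have := refl' w hw.ge
    simp only [hw, mul_zero, zero_mul] at this
    exact nonneg_of_mul_nonneg_right this (by positivity)
  have orth : ∀ w, inner ℝ u w = 0 → inner ℝ e w = 0 := by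
    intro w hw
    have h1 := orth_nonneg w hw
    have h2 := orth_nonneg (-w) (by rw [inner_neg_right, hw, neg_zero])
    rw [inner_neg_right] at h2
    linarith
  -- Since `e` vanishes on the orthogonal complement of `u`, it is a multiple of `u`; pairing with
  -- `u` gives the factor `2 * l`.
  set l : ℝ := inner ℝ e u / (2 * r ^ 2) with hl
  have huu : inner ℝ u u = r ^ 2 := by rw [real_inner_self_eq_norm_sq, hur]
  have stat : ∀ w, inner ℝ e w = 2 * l * inner ℝ u w := by
    intro w
    have h1 := orth (w - (inner ℝ u w / r ^ 2) • u) (by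
      rw [inner_sub_right, inner_smul_right, huu]
      field_simp
      ring)
    rw [inner_sub_right, inner_smul_right] at h1
    rw [hl]
    field_simp
    field_simp at h1
    linarith
  -- Divide the reflection inequality by `2 * inner ℝ u w`. Both sides of the result are even in
  -- `w`, so it then extends to the whole space.
  have curv_pos : ∀ w, 0 ≤ inner ℝ u w → inner ℝ w (T w) ≤ l * ‖w‖ ^ 2 := by
    refine le_of_forall_inner_pos hu0 (by fun_prop) (by fun_prop) fun w hw => ?_
    have h1 := refl w hw
    rw [stat] at h1
    nlinarith
  have curv : ∀ w, inner ℝ w (T w) ≤ l * ‖w‖ ^ 2 := by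
    intro w
    rcases le_total 0 (inner ℝ u w) with hw | hw
    · exact curv_pos w hw
    · simpa using curv_pos (-w) (by rw [inner_neg_right]; linarith)
  refine ⟨l, ?_, u, hur.le, by rw [hur, sub_self, mul_zero], fun v => ?_⟩
  · have h1 := (hT u).trans (curv u)
    rw [hur] at h1
    exact nonneg_of_mul_nonneg_left h1 (by positivity)
  -- Expanded at `u`, the Lagrangian has no linear term, and its quadratic term is nonpositive by
  -- `curv`.
  · obtain ⟨w, rfl⟩ : ∃ w, v = u + w := ⟨v - u, by abel⟩
    rw [expand, hsq, stat]
    linarith [curv w]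

/-- The separable version of `exists_multiplier_ball`: finitely many translates of one convex
quadratic function, coupled only by a bound on the sum of the squared norms. -/
theorem exists_multiplier_sum {E ι : Type*} [NormedAddCommGroup E] [InnerProductSpace ℝ E]
    [FiniteDimensional ℝ E] [Fintype ι] (T : E →L[ℝ] E) (hT : ∀ w, 0 ≤ inner ℝ w (T w)) (p : E)
    (s : ι → E) {r : ℝ} (hr : 0 < r) :
    ∃ l : ℝ, 0 ≤ l ∧ ∃ ξ : ι → E, ∑ k, ‖ξ k - s k‖ ^ 2 ≤ r ^ 2 ∧
      l * (r ^ 2 - ∑ k, ‖ξ k - s k‖ ^ 2) = 0 ∧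
      ∀ k v, inner ℝ v (T v) + inner ℝ p v - l * ‖v - s k‖ ^ 2 ≤
        inner ℝ (ξ k) (T (ξ k)) + inner ℝ p (ξ k) - l * ‖ξ k - s k‖ ^ 2 := by
  classical
  -- Block-diagonal copy of `T`. Recentring block k at `s k` changes only the linear term and a
  -- constant.
  let S : PiLp 2 (fun _ : ι => E) →L[ℝ] PiLp 2 (fun _ : ι => E) :=
    LinearMap.toContinuousLinearMap
      { toFun := fun u => WithLp.toLp 2 fun k => T (u k)
        map_add' := fun u v => by ext k; simp
        map_smul' := fun a u => by ext k; simp }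
  have hS : ∀ u k, S u k = T (u k) := fun u k => rfl
  have hnorm : ∀ u : PiLp 2 (fun _ : ι => E), ‖u‖ ^ 2 = ∑ k, ‖u k‖ ^ 2 := fun u =>
    PiLp.norm_sq_eq_of_L2 _ u
  obtain ⟨l, hl, u, hur, hcomp, hmax⟩ := exists_multiplier_ball S
    (fun w => by
      simp only [PiLp.inner_apply, hS]
      exact Finset.sum_nonneg fun k _ => hT _)
    (WithLp.toLp 2 fun k => ContinuousLinearMap.adjoint T (s k) + T (s k) + p) hr
  refine ⟨l, hl, fun k => s k + u k, ?_, ?_, fun k v => ?_⟩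
  · simp only [add_sub_cancel_left, ← hnorm]
    exact pow_le_pow_left₀ (norm_nonneg _) hur 2
  · simpa only [add_sub_cancel_left, ← hnorm] using hcomp
  · obtain ⟨w, rfl⟩ : ∃ w, v = s k + w := ⟨v - s k, by abel⟩
    -- Varying a single block cancels all other summands.
    have h := hmax (WithLp.toLp 2 (Function.update u.ofLp k w))
    simp only [hnorm, PiLp.inner_apply, hS, Finset.mul_sum, ← Finset.sum_add_distrib,
      ← Finset.sum_sub_distrib] at h
    rw [← Finset.add_sum_erase _ _ (Finset.mem_univ k),
      ← Finset.add_sum_erase _ _ (Finset.mem_univ k)] at h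
    rw [Finset.sum_congr rfl (g := fun j => inner ℝ (u j) (T (u j)) +
      inner ℝ (ContinuousLinearMap.adjoint T (s j) + T (s j) + p) (u j) - l * ‖u j‖ ^ 2)
      (fun j hj => by simp [Function.update_of_ne (Finset.ne_of_mem_erase hj)])] at h
    have h' := le_of_add_le_add_right h
    simp only [Function.update_self, inner_add_left,
      ContinuousLinearMap.adjoint_inner_left] at h'
    simp only [add_sub_cancel_left, map_add, inner_add_left, inner_add_right]
    rw [real_inner_comm (T (s k)) w, real_inner_comm (T (s k)) (u k)]
    linarith

/-! ### Empirical measures -/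

section Empirical

variable {m K : ℕ}

theorem isProbabilityMeasure_empirical (hK : 0 < K) (s : Fin K → EuclideanSpace ℝ (Fin m)) :
    IsProbabilityMeasure (empirical s) := by
  constructor
  have hK' : (K : ℝ≥0∞) ≠ 0 := by exact_mod_cast hK.ne'
  simp [empirical, ENNReal.inv_mul_cancel hK' (ENNReal.natCast_ne_top K)]

theorem integrable_empirical (hK : 0 < K) (s : Fin K → EuclideanSpace ℝ (Fin m))
    {F : Type*} [NormedAddCommGroup F] (φ : EuclideanSpace ℝ (Fin m) → F) :
    Integrable φ (empirical s) := by
  refine Integrable.smul_measure ?_ (by simpa using hK.ne')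
  exact integrable_finsetSum_measure.2 fun k _ => integrable_dirac (by simp)

theorem integral_empirical (s : Fin K → EuclideanSpace ℝ (Fin m))
    (φ : EuclideanSpace ℝ (Fin m) → ℝ) :
    ∫ ξ, φ ξ ∂empirical s = 1 / (K : ℝ) * ∑ k, φ (s k) := by
  rw [empirical, integral_smul_measure, integral_finsetSum_measure
    fun k _ => integrable_dirac (by simp)]
  simp

theorem ae_empirical_mem_range (s : Fin K → EuclideanSpace ℝ (Fin m)) :
    ∀ᵐ ζ ∂empirical s, ζ ∈ range s := by
  have hm : MeasurableSet (range s)ᶜ := (finite_range s).measurableSet.compl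
  change empirical s (range s)ᶜ = 0
  simp [empirical, Measure.dirac_apply' _ hm]

/-- Pairing each atom `ξ k` with `s k` is one admissible coupling. -/
theorem wasserstein2_empirical_le (hK : 0 < K) (ξ s : Fin K → EuclideanSpace ℝ (Fin m)) {ε : ℝ}
    (hε : 0 ≤ ε) (h : ∑ k, ‖ξ k - s k‖ ^ 2 ≤ K * ε ^ 2) :
    wasserstein2 (empirical ξ) (empirical s) ≤ ENNReal.ofReal ε := by
  set π : Measure (EuclideanSpace ℝ (Fin m) × EuclideanSpace ℝ (Fin m)) :=
    (K : ℝ≥0∞)⁻¹ • ∑ k, Measure.dirac (ξ k, s k) with hπ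
  have hmap : ∀ g : EuclideanSpace ℝ (Fin m) × EuclideanSpace ℝ (Fin m) →
      EuclideanSpace ℝ (Fin m), Measurable g → π.map g = empirical fun k => g (ξ k, s k) := by
    intro g hg
    rw [hπ, Measure.map_smul, ← Measure.mapₗ_apply_of_measurable hg, map_sum, empirical]
    simp [Measure.mapₗ_apply_of_measurable hg, Measure.map_dirac' hg]
  have hmem : π ∈ couplings (empirical ξ) (empirical s) :=
    ⟨hmap _ measurable_fst, hmap _ measurable_snd⟩
  have hcost : ∫⁻ z, ‖z.1 - z.2‖ₑ ^ 2 ∂π ≤ ENNReal.ofReal ε ^ (2 : ℝ) := by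
    rw [hπ, lintegral_smul_measure, lintegral_finsetSum_measure]
    simp only [lintegral_dirac, smul_eq_mul]
    rw [mul_comm, ← div_eq_mul_inv]
    refine ENNReal.div_le_of_le_mul ?_
    have h1 : ∀ k, ‖ξ k - s k‖ₑ ^ 2 = ENNReal.ofReal (‖ξ k - s k‖ ^ 2) := fun k => by
      rw [ENNReal.ofReal_pow (norm_nonneg _), ofReal_norm]
    simp only [h1]
    rw [← ENNReal.ofReal_sum_of_nonneg fun k _ => by positivity]
    refine (ENNReal.ofReal_le_ofReal h).trans ?_
    rw [ENNReal.ofReal_mul (by positivity), ENNReal.ofReal_natCast, ENNReal.ofReal_pow hε,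
      mul_comm]
    simp
  calc wasserstein2 (empirical ξ) (empirical s)
      ≤ (ENNReal.ofReal ε ^ (2 : ℝ)) ^ (1 / 2 : ℝ) :=
        ENNReal.rpow_le_rpow ((iInf₂_le π hmem).trans hcost) (by norm_num)
    _ = ENNReal.ofReal ε := by rw [← ENNReal.rpow_mul]; norm_num

end Empirical

/-! ### Couplings, second moments and the weak duality estimate -/

section Coupling

variable {m K : ℕ} {μ : Measure (EuclideanSpace ℝ (Fin m))}

/-- The slack `δ` avoids the existence of an optimal coupling. -/
theorem exists_coupling_lt {ν : Measure (EuclideanSpace ℝ (Fin m))} {ε δ : ℝ} (hε : 0 ≤ ε)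
    (hδ : 0 < δ) (h : wasserstein2 μ ν ≤ ENNReal.ofReal ε) :
    ∃ π ∈ couplings μ ν, ∫⁻ z, ‖z.1 - z.2‖ₑ ^ 2 ∂π < ENNReal.ofReal (ε ^ 2 + δ) := by
  have h1 : (⨅ π ∈ couplings μ ν, ∫⁻ z, ‖z.1 - z.2‖ₑ ^ 2 ∂π) < ENNReal.ofReal (ε ^ 2 + δ) := by
    have h2 := ENNReal.rpow_le_rpow h (zero_le_two (α := ℝ))
    rw [wasserstein2, ← ENNReal.rpow_mul] at h2
    norm_num at h2
    rw [← ENNReal.ofReal_pow hε] at h2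
    exact h2.trans_lt ((ENNReal.ofReal_lt_ofReal_iff (by positivity)).2 (by linarith))
  simpa [iInf_lt_iff] using h1

theorem memLp_two_sub_of_lintegral_lt_top
    {π : Measure (EuclideanSpace ℝ (Fin m) × EuclideanSpace ℝ (Fin m))}
    (h : ∫⁻ z, ‖z.1 - z.2‖ₑ ^ 2 ∂π < ⊤) : MemLp (fun z => z.1 - z.2) 2 π := by
  refine ⟨by fun_prop, ?_⟩
  rw [eLpNorm_lt_top_iff_lintegral_rpow_enorm_lt_top (by norm_num) (by norm_num)]
  simpa using h

/-- Under a coupling, ξ = (ξ - ζ) + ζ is a sum of two L² functions, as ζ takes finitely many values.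
-/
theorem memLp_two_id_of_wasserstein2_le (hK : 0 < K) (s : Fin K → EuclideanSpace ℝ (Fin m))
    {ε : ℝ} (hε : 0 ≤ ε) (h : wasserstein2 μ (empirical s) ≤ ENNReal.ofReal ε) :
    MemLp id 2 μ := by
  obtain ⟨π, ⟨hfst, hsnd⟩, hlt⟩ := exists_coupling_lt hε one_pos h
  have h1 := memLp_two_sub_of_lintegral_lt_top (hlt.trans ENNReal.ofReal_lt_top)
  have h2 : MemLp (id : EuclideanSpace ℝ (Fin m) → _) 2 (π.map Prod.snd) := by
    change MemLp id 2 π.snd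
    rw [hsnd, memLp_two_iff_integrable_sq_norm aestronglyMeasurable_id]
    exact integrable_empirical hK s _
  have h3 := h1.add (h2.comp_of_map measurable_snd.aemeasurable)
  rw [← hfst, Measure.fst, memLp_map_measure_iff aestronglyMeasurable_id (by fun_prop)]
  convert! h3 using 1
  ext1 z
  simp

theorem integrable_quadratic [IsFiniteMeasure μ] (hμ : MemLp id 2 μ)
    (T : EuclideanSpace ℝ (Fin m) →L[ℝ] EuclideanSpace ℝ (Fin m))
    (p : EuclideanSpace ℝ (Fin m)) :
    Integrable (fun ξ => inner ℝ ξ (T ξ) + inner ℝ p ξ) μ := by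
  refine Integrable.add ?_ ?_
  · exact (hμ.norm.integrable_mul (T.comp_memLp' hμ).norm).mono' (by fun_prop)
      (.of_forall fun ξ => by simpa using norm_inner_le_norm (𝕜 := ℝ) ξ (T ξ))
  · exact (hμ.integrable one_le_two).const_inner p

theorem integral_le_of_wasserstein2_le [IsProbabilityMeasure μ] (hK : 0 < K)
    (s : Fin K → EuclideanSpace ℝ (Fin m)) {ε : ℝ} (hε : 0 ≤ ε)
    (hμ : wasserstein2 μ (empirical s) ≤ ENNReal.ofReal ε)
    {h : EuclideanSpace ℝ (Fin m) → ℝ} (hint : Integrable h μ) {l : ℝ} (hl : 0 ≤ l)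
    {c : Fin K → ℝ} (hc : ∀ k ξ, h ξ - l * ‖ξ - s k‖ ^ 2 ≤ c k) :
    ∫ ξ, h ξ ∂μ ≤ l * ε ^ 2 + 1 / (K : ℝ) * ∑ k, c k := by
  -- Away from the samples this real supremum may be unbounded and take a default value; the second
  -- marginal charges only the samples.
  set φ : EuclideanSpace ℝ (Fin m) → ℝ := fun ζ => ⨆ ξ, (h ξ - l * ‖ξ - ζ‖ ^ 2) with hφ
  have hφc : ∀ k, φ (s k) ≤ c k := fun k => ciSup_le (hc k)
  have key : ∀ δ : ℝ, 0 < δ →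
      ∫ ξ, h ξ ∂μ ≤ l * (ε ^ 2 + δ) + 1 / (K : ℝ) * ∑ k, c k := by
    intro δ hδ
    obtain ⟨π, ⟨hfst, hsnd⟩, hlt⟩ := exists_coupling_lt hε hδ hμ
    have hsq : Integrable (fun z => ‖z.1 - z.2‖ ^ 2) π :=
      (memLp_two_sub_of_lintegral_lt_top (hlt.trans ENNReal.ofReal_lt_top)).norm.integrable_sq
    have hφi : Integrable φ (π.map Prod.snd) := by
      change Integrable φ π.snd
      rw [hsnd]
      exact integrable_empirical hK s φ
    have hhi : Integrable h (π.map Prod.fst) := by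
      change Integrable h π.fst
      rwa [hfst]
    have hae : ∀ᵐ z ∂π, z.2 ∈ range s := by
      refine ae_of_ae_map measurable_snd.aemeasurable ?_
      change ∀ᵐ ζ ∂π.snd, ζ ∈ range s
      rw [hsnd]
      exact ae_empirical_mem_range s
    have h1 : ∫ ξ, h ξ ∂μ = ∫ z, h z.1 ∂π := by
      rw [← hfst]
      exact integral_map measurable_fst.aemeasurable hhi.1
    have h2 : ∫ z, φ z.2 ∂π = 1 / (K : ℝ) * ∑ k, φ (s k) := by
      rw [← integral_empirical, ← hsnd]
      exact (integral_map measurable_snd.aemeasurable hφi.1).symm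
    have h3 : ∫ z, ‖z.1 - z.2‖ ^ 2 ∂π ≤ ε ^ 2 + δ := by
      rw [integral_eq_lintegral_of_nonneg_ae (.of_forall fun z => by positivity) hsq.1]
      refine ENNReal.toReal_le_of_le_ofReal (by positivity) ?_
      refine le_of_eq_of_le (lintegral_congr fun z => ?_) hlt.le
      rw [ENNReal.ofReal_pow (norm_nonneg _), ofReal_norm]
    have h4 : ∫ z, h z.1 ∂π ≤ ∫ z, (l * ‖z.1 - z.2‖ ^ 2 + φ z.2) ∂π := by
      refine integral_mono_ae (hhi.comp_measurable measurable_fst)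
        ((hsq.const_mul l).add (hφi.comp_measurable measurable_snd)) ?_
      filter_upwards [hae] with z ⟨k, hk⟩
      have h5 : h z.1 - l * ‖z.1 - z.2‖ ^ 2 ≤ φ z.2 :=
        le_ciSup (f := fun ξ => h ξ - l * ‖ξ - z.2‖ ^ 2)
          ⟨c k, by rintro _ ⟨ξ, rfl⟩; simpa only [← hk] using hc k ξ⟩ z.1
      linarith
    have h5 : ∫ z, (l * ‖z.1 - z.2‖ ^ 2 + φ z.2) ∂π =
        l * ∫ z, ‖z.1 - z.2‖ ^ 2 ∂π + ∫ z, φ z.2 ∂π := by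
      rw [← integral_const_mul]
      exact integral_add (hsq.const_mul l) (hφi.comp_measurable measurable_snd)
    have h6 : 1 / (K : ℝ) * ∑ k, φ (s k) ≤ 1 / (K : ℝ) * ∑ k, c k :=
      mul_le_mul_of_nonneg_left (Finset.sum_le_sum fun k _ => hφc k) (by positivity)
    have h7 := mul_le_mul_of_nonneg_left h3 hl
    linarith
  refine le_of_forall_pos_le_add fun η hη => ?_
  -- `l + 1` rather than `l`, since `l` may be zero.
  have h1 := key (η / (l + 1)) (by positivity)
  have h2 : l * (η / (l + 1)) ≤ η := by
    rw [mul_div_assoc', div_le_iff₀ (by positivity)]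
    nlinarith
  linarith

end Coupling

/-! ### Extended-real sums and the inner-product form of the cost -/

theorem EReal.sum_ne_bot {ι : Type*} {t : Finset ι} {a : ι → EReal} (h : ∀ k ∈ t, a k ≠ ⊥) :
    ∑ k ∈ t, a k ≠ ⊥ :=
  Finset.sum_induction a (· ≠ ⊥) (fun _ _ hx hy => EReal.add_ne_bot_iff.2 ⟨hx, hy⟩)
    EReal.zero_ne_bot h

theorem EReal.sum_eq_top {ι : Type*} {t : Finset ι} {a : ι → EReal} (h : ∀ k ∈ t, a k ≠ ⊥)
    {j : ι} (hj : j ∈ t) (hja : a j = ⊤) : ∑ k ∈ t, a k = ⊤ := by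
  classical
  rw [← Finset.add_sum_erase t a hj, hja]
  exact EReal.top_add_of_ne_bot (EReal.sum_ne_bot fun k hk => h k (Finset.mem_of_mem_erase hk))

theorem EReal.coe_sum {ι : Type*} (t : Finset ι) (a : ι → ℝ) :
    ((∑ k ∈ t, a k : ℝ) : EReal) = ∑ k ∈ t, (a k : EReal) :=
  map_sum (⟨⟨Real.toEReal, EReal.coe_zero⟩, EReal.coe_add⟩ : ℝ →+ EReal) a t

theorem quadBilin_eq_inner {N n m : ℕ} (Q : Matrix (Fin m) (Fin m) ℝ)
    (A : Matrix (Fin m) (Fin N × Fin n) ℝ) (b : Fin m → ℝ)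
    (x : Fin N → EuclideanSpace ℝ (Fin n)) (ξ : EuclideanSpace ℝ (Fin m)) :
    quadBilin Q A b x ξ = inner ℝ ξ (Matrix.toEuclideanCLM (𝕜 := ℝ) Q ξ) +
      inner ℝ (WithLp.toLp 2 (affineP A b x)) ξ := by
  rw [Matrix.inner_toEuclideanCLM, quadBilin, EuclideanSpace.inner_eq_star_dotProduct,
    star_trivial, dotProduct_comm (affineP A b x)]

/-! ### Duality at a fixed strategy profile -/

namespace DRGame

variable {N n m : ℕ} (G : DRGame N n m) {Q : Fin N → Matrix (Fin m) (Fin m) ℝ}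
  {A : Fin N → Matrix (Fin m) (Fin N × Fin n) ℝ} {b : Fin N → Fin m → ℝ} (i : Fin N)
  (x : Fin N → EuclideanSpace ℝ (Fin n))

theorem CostAssumption.inner_toEuclideanCLM_nonneg {G : DRGame N n m}
    (hG : G.CostAssumption Q A b) (i : Fin N) (w : EuclideanSpace ℝ (Fin m)) :
    0 ≤ inner ℝ w (Matrix.toEuclideanCLM (𝕜 := ℝ) (Q i) w) := by
  obtain ⟨L, -, d, hd, -, hQ⟩ := hG.spectral i
  have h : (Q i).PosSemidef := by
    rw [hQ, ← Matrix.conjTranspose_eq_transpose_of_trivial]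
    exact (Matrix.PosSemidef.diagonal hd).conjTranspose_mul_mul_same L
  rw [Matrix.inner_toEuclideanCLM]
  simpa using h.dotProduct_mulVec_nonneg w.ofLp

theorem CostAssumption.integrable_g {G : DRGame N n m} (hG : G.CostAssumption Q A b) (i : Fin N)
    (hK : 0 < G.K i) (hε : 0 ≤ G.ε i) (x : Fin N → EuclideanSpace ℝ (Fin n))
    {μ : Measure (EuclideanSpace ℝ (Fin m))} (hμ : μ ∈ G.ball i) : Integrable (G.g i x) μ := by
  have := hμ.1
  refine (integrable_quadratic (memLp_two_id_of_wasserstein2_le hK _ hε hμ.2)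
    (Matrix.toEuclideanCLM (𝕜 := ℝ) (Q i)) (WithLp.toLp 2 (affineP (A i) (b i) x))).congr ?_
  exact .of_forall fun ξ => by rw [hG.form, quadBilin_eq_inner]

theorem CostAssumption.expCost_empirical {G : DRGame N n m} (hG : G.CostAssumption Q A b)
    (i : Fin N) (x : Fin N → EuclideanSpace ℝ (Fin n))
    (ξ : Fin (G.K i) → EuclideanSpace ℝ (Fin m)) :
    G.expCost i x (empirical ξ) =
      G.f i x + 1 / (G.K i : ℝ) * ∑ k, quadBilin (Q i) (A i) (b i) x (ξ k) := by
  simp only [expCost, integral_empirical, hG.form]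

theorem empirical_mem_ball (hK : 0 < G.K i) (hε : 0 ≤ G.ε i)
    {ξ : Fin (G.K i) → EuclideanSpace ℝ (Fin m)}
    (h : ∑ k, ‖ξ k - G.sample i k‖ ^ 2 ≤ G.K i * G.ε i ^ 2) : empirical ξ ∈ G.ball i :=
  ⟨isProbabilityMeasure_empirical hK ξ, wasserstein2_empirical_le hK ξ _ hε h⟩

theorem dualCost_eq_coe {l : ℝ} {c : Fin (G.K i) → ℝ}
    (hc : ∀ k, (⨆ ξ : EuclideanSpace ℝ (Fin m),
      ((quadBilin (Q i) (A i) (b i) x ξ - l * ‖ξ - G.sample i k‖ ^ 2 : ℝ) : EReal)) = c k) :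
    G.dualCost Q A b i x l =
      ((G.f i x + l * G.ε i ^ 2 + 1 / (G.K i : ℝ) * ∑ k, c k : ℝ) : EReal) := by
  rw [dualCost, Finset.sum_congr rfl fun k _ => hc k, ← EReal.coe_sum, ← EReal.coe_mul,
    ← EReal.coe_add]

/-- Weak duality. -/
theorem CostAssumption.worstCost_le_dualCost {G : DRGame N n m} (hG : G.CostAssumption Q A b)
    (i : Fin N) (hK : 0 < G.K i) (hε : 0 ≤ G.ε i) (x : Fin N → EuclideanSpace ℝ (Fin n)) {l : ℝ}
    (hl : 0 ≤ l) : G.worstCost i x ≤ G.dualCost Q A b i x l := by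
  set S : Fin (G.K i) → EReal := fun k => ⨆ ξ : EuclideanSpace ℝ (Fin m),
    ((quadBilin (Q i) (A i) (b i) x ξ - l * ‖ξ - G.sample i k‖ ^ 2 : ℝ) : EReal) with hS
  have hle : ∀ k ξ, ((quadBilin (Q i) (A i) (b i) x ξ - l * ‖ξ - G.sample i k‖ ^ 2 : ℝ) : EReal)
      ≤ S k := fun k ξ => le_iSup (fun ξ : EuclideanSpace ℝ (Fin m) =>
        ((quadBilin (Q i) (A i) (b i) x ξ - l * ‖ξ - G.sample i k‖ ^ 2 : ℝ) : EReal)) ξ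
  have hbot : ∀ k, S k ≠ ⊥ := fun k => ((EReal.bot_lt_coe _).trans_le (hle k 0)).ne'
  by_cases htop : ∃ k, S k = ⊤
  · obtain ⟨k, hk⟩ := htop
    have hpos : (0 : ℝ) < 1 / (G.K i : ℝ) := by positivity
    have hsum : ∑ k, S k = ⊤ := EReal.sum_eq_top (fun k _ => hbot k) (Finset.mem_univ k) hk
    have : G.dualCost Q A b i x l = ⊤ := by
      change _ + _ * ∑ k, S k = ⊤
      rw [hsum, EReal.coe_mul_top_of_pos hpos, EReal.coe_add_top]
    rw [this]
    exact le_top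
  · push Not at htop
    have hc : ∀ k, S k = ((S k).toReal : EReal) := fun k =>
      (EReal.coe_toReal (htop k) (hbot k)).symm
    rw [G.dualCost_eq_coe i x hc]
    refine iSup₂_le fun μ hμ => ?_
    have := hμ.1
    have h := integral_le_of_wasserstein2_le hK (G.sample i) hε hμ.2
      (hG.integrable_g i hK hε x hμ) hl (c := fun k => (S k).toReal) fun k ξ => by
        have := hle k ξ
        rw [hc k, EReal.coe_le_coe_iff] at this
        rwa [hG.form]
    rw [EReal.coe_le_coe_iff, expCost]
    linarith

/-- Strong duality with an empirical distribution in a ball of radius `r`, which may exceed the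
radius of the ambiguity ball. -/
theorem CostAssumption.exists_dualCost_le {G : DRGame N n m} (hG : G.CostAssumption Q A b)
    (i : Fin N) (hK : 0 < G.K i) (hε : 0 ≤ G.ε i) (x : Fin N → EuclideanSpace ℝ (Fin n)) {r : ℝ}
    (hr : 0 < r) (hrε : G.ε i ≤ r) :
    ∃ l ∈ Ici (0 : ℝ), ∃ ξ : Fin (G.K i) → EuclideanSpace ℝ (Fin m),
      ∑ k, ‖ξ k - G.sample i k‖ ^ 2 ≤ G.K i * r ^ 2 ∧
      G.dualCost Q A b i x l ≤ (G.expCost i x (empirical ξ) : EReal) := by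
  have hK' : (0 : ℝ) < G.K i := by exact_mod_cast hK
  -- The factor `√(G.K i)` turns a bound on the mean squared displacement into one on the sum.
  obtain ⟨l, hl, ξ, hξ, hcomp, hmax⟩ := exists_multiplier_sum
    (Matrix.toEuclideanCLM (𝕜 := ℝ) (Q i)) (hG.inner_toEuclideanCLM_nonneg i)
    (WithLp.toLp 2 (affineP (A i) (b i) x)) (G.sample i) (r := √(G.K i) * r) (by positivity)
  rw [mul_pow, Real.sq_sqrt hK'.le] at hξ hcomp
  refine ⟨l, hl, ξ, hξ, ?_⟩
  rw [G.dualCost_eq_coe i x (c := fun k =>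
    quadBilin (Q i) (A i) (b i) x (ξ k) - l * ‖ξ k - G.sample i k‖ ^ 2), hG.expCost_empirical,
    EReal.coe_le_coe_iff, Finset.sum_sub_distrib, ← Finset.mul_sum]
  · have h1 : l * G.ε i ^ 2 ≤ l * r ^ 2 :=
      mul_le_mul_of_nonneg_left (pow_le_pow_left₀ hε hrε 2) hl
    -- Complementary slackness: the mean penalty cancels the radius term.
    have h2 : 1 / (G.K i : ℝ) * (l * ∑ k, ‖ξ k - G.sample i k‖ ^ 2) = l * r ^ 2 := by
      field_simp
      linarith
    rw [mul_sub, h2]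
    linarith
  · intro k
    refine le_antisymm (iSup_le fun v => ?_) (le_iSup (fun ξ : EuclideanSpace ℝ (Fin m) =>
      ((quadBilin (Q i) (A i) (b i) x ξ - l * ‖ξ - G.sample i k‖ ^ 2 : ℝ) : EReal)) (ξ k))
    rw [EReal.coe_le_coe_iff, quadBilin_eq_inner, quadBilin_eq_inner]
    exact hmax k v

theorem continuous_quadBilin (Q : Matrix (Fin m) (Fin m) ℝ)
    (A : Matrix (Fin m) (Fin N × Fin n) ℝ) (b : Fin m → ℝ)
    (x : Fin N → EuclideanSpace ℝ (Fin n)) : Continuous (quadBilin Q A b x) := by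
  have : quadBilin Q A b x = _ := funext fun ξ => quadBilin_eq_inner Q A b x ξ
  rw [this]
  fun_prop

/-- The dual values come arbitrarily close to the nominal cost if the radius is zero. -/
theorem CostAssumption.iInf_dualCost_le_of_radius_eq_zero {G : DRGame N n m}
    (hG : G.CostAssumption Q A b) (i : Fin N) (hK : 0 < G.K i) (hε : G.ε i = 0)
    (x : Fin N → EuclideanSpace ℝ (Fin n)) :
    ⨅ l ∈ Ici (0 : ℝ), G.dualCost Q A b i x l ≤
      (G.expCost i x (empirical (G.sample i)) : EReal) := by
  have hK' : (0 : ℝ) < G.K i := by exact_mod_cast hK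
  have hcont : Continuous fun ξ : Fin (G.K i) → EuclideanSpace ℝ (Fin m) =>
      G.expCost i x (empirical ξ) := by
    simp only [hG.expCost_empirical]
    have := continuous_quadBilin (Q i) (A i) (b i) x
    fun_prop
  refine EReal.le_of_forall_lt_iff_le.1 fun z hz => ?_
  obtain ⟨η, hη, hball⟩ := Metric.eventually_nhds_iff.1
    (hcont.continuousAt.eventually (gt_mem_nhds (EReal.coe_lt_coe_iff.1 hz)))
  -- With this radius each atom moves by at most `η / 2`.
  obtain ⟨l, hl, ξ, hξ, hle⟩ := hG.exists_dualCost_le i hK hε.ge x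
    (r := η / 2 / √(G.K i)) (by positivity) (by rw [hε]; positivity)
  refine (iInf₂_le l hl).trans (hle.trans (EReal.coe_le_coe_iff.2 (hball ?_).le))
  rw [dist_pi_lt_iff hη]
  intro k
  have h1 : ‖ξ k - G.sample i k‖ ^ 2 ≤ (η / 2) ^ 2 := by
    refine (Finset.single_le_sum (f := fun k => ‖ξ k - G.sample i k‖ ^ 2)
      (fun k _ => by positivity) (Finset.mem_univ k)).trans (hξ.trans_eq ?_)
    rw [div_pow, Real.sq_sqrt hK'.le]
    field_simp
  rw [dist_eq_norm]
  exact ((sq_le_sq₀ (norm_nonneg _) (by positivity)).1 h1).trans_lt (half_lt_self hη)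

/-- Strong duality for the worst-case cost at a fixed strategy profile. -/
theorem CostAssumption.worstCost_duality {G : DRGame N n m} (hG : G.CostAssumption Q A b)
    (i : Fin N) (hK : 0 < G.K i) (hε : 0 ≤ G.ε i) (x : Fin N → EuclideanSpace ℝ (Fin n)) :
    (∃ μ ∈ G.ball i, (G.expCost i x μ : EReal) = G.worstCost i x) ∧
      G.worstCost i x = ⨅ l ∈ Ici (0 : ℝ), G.dualCost Q A b i x l ∧
      (0 < G.ε i → ∃ l ∈ Ici (0 : ℝ), G.dualCost Q A b i x l = G.worstCost i x) := by
  have weak : G.worstCost i x ≤ ⨅ l ∈ Ici (0 : ℝ), G.dualCost Q A b i x l :=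
    le_iInf₂ fun l hl => hG.worstCost_le_dualCost i hK hε x hl
  have lower : ∀ μ ∈ G.ball i, (G.expCost i x μ : EReal) ≤ G.worstCost i x := fun μ hμ =>
    le_iSup₂ (f := fun μ (_ : μ ∈ G.ball i) => (G.expCost i x μ : EReal)) μ hμ
  rcases hε.eq_or_lt with h0 | hpos
  · have hmem : empirical (G.sample i) ∈ G.ball i :=
      G.empirical_mem_ball i hK hε (by simp [← h0])
    have h := hG.iInf_dualCost_le_of_radius_eq_zero i hK h0.symm x
    exact ⟨⟨_, hmem, (lower _ hmem).antisymm (weak.trans h)⟩,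
      weak.antisymm (h.trans (lower _ hmem)), fun hpos => absurd h0 hpos.ne⟩
  · obtain ⟨l, hl, ξ, hξ, hle⟩ := hG.exists_dualCost_le i hK hε x hpos le_rfl
    have hmem := G.empirical_mem_ball i hK hε hξ
    have hl' := hG.worstCost_le_dualCost i hK hε x hl
    exact ⟨⟨_, hmem, (lower _ hmem).antisymm (hl'.trans hle)⟩,
      weak.antisymm ((iInf₂_le l hl).trans (hle.trans (lower _ hmem))),
      fun _ => ⟨l, hl, (hle.trans (lower _ hmem)).antisymm hl'⟩⟩

end DRGame

/-! ### Passage to the agent's optimization problem -/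

theorem lemma1 {N n m : ℕ} (G : DRGame N n m)
    (Q : Fin N → Matrix (Fin m) (Fin m) ℝ)
    (A : Fin N → Matrix (Fin m) (Fin N × Fin n) ℝ) (b : Fin N → Fin m → ℝ)
    (hG : G.CostAssumption Q A b)
    (hK : ∀ i, 0 < G.K i) (hε : ∀ i, 0 ≤ G.ε i)
    (i : Fin N) (x : Fin N → EuclideanSpace ℝ (Fin n)) :
    -- the expectations are well defined on the ambiguity ball
    (∀ (y : EuclideanSpace ℝ (Fin n)), ∀ μ ∈ G.ball i,
      Integrable (G.g i (Function.update x i y)) μ) ∧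
    -- for every own decision `y`, the worst case is a maximum and equals the dual value,
    -- which is a minimum if the radius is positive
    (∀ y : EuclideanSpace ℝ (Fin n),
      (∃ μ ∈ G.ball i, (G.expCost i (Function.update x i y) μ : EReal) =
        G.worstCost i (Function.update x i y)) ∧
      G.worstCost i (Function.update x i y) =
        ⨅ l ∈ Ici (0 : ℝ), G.dualCost Q A b i (Function.update x i y) l ∧
      (0 < G.ε i → ∃ l ∈ Ici (0 : ℝ), G.dualCost Q A b i (Function.update x i y) l =
        G.worstCost i (Function.update x i y))) ∧
    -- the agent's problem and the joint problem in `(x_i, l)` have the same optimal value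
    ((⨅ y ∈ G.X i, G.worstCost i (Function.update x i y)) =
      ⨅ p ∈ G.X i ×ˢ Ici (0 : ℝ), G.dualCost Q A b i (Function.update x i p.1) p.2) ∧
    -- and, for a positive radius, the same optimal decisions
    (0 < G.ε i → ∀ y ∈ G.X i,
      (IsMinOn (fun y' => G.worstCost i (Function.update x i y')) (G.X i) y ↔
        ∃ l ∈ Ici (0 : ℝ),
          IsMinOn (fun p : EuclideanSpace ℝ (Fin n) × ℝ =>
            G.dualCost Q A b i (Function.update x i p.1) p.2) (G.X i ×ˢ Ici (0 : ℝ)) (y, l))) := by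
  have hint := fun y μ hμ => hG.integrable_g i (hK i) (hε i) (Function.update x i y) (μ := μ) hμ
  have dual := fun y => hG.worstCost_duality i (hK i) (hε i) (Function.update x i y)
  have weak : ∀ y, ∀ l ∈ Ici (0 : ℝ), G.worstCost i (Function.update x i y) ≤
      G.dualCost Q A b i (Function.update x i y) l := fun y l hl =>
    hG.worstCost_le_dualCost i (hK i) (hε i) _ hl
  refine ⟨hint, dual, ?_, fun hpos y hy => ⟨fun hmin => ?_, ?_⟩⟩
  · refine le_antisymm (le_iInf₂ fun p hp => (iInf₂_le p.1 hp.1).trans (weak p.1 p.2 hp.2))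
      (le_iInf₂ fun y hy => ?_)
    rw [(dual y).2.1]
    exact le_iInf₂ fun l hl => iInf₂_le (y, l) (mk_mem_prod hy hl)
  -- The positive radius enters here, through an attained multiplier at `y`.
  · obtain ⟨l, hl, hl_eq⟩ := (dual y).2.2 hpos
    exact ⟨l, hl, isMinOn_iff.2 fun p hp =>
      hl_eq.le.trans ((isMinOn_iff.1 hmin p.1 hp.1).trans (weak p.1 p.2 hp.2))⟩
  · rintro ⟨l, hl, hmin⟩
    refine isMinOn_iff.2 fun y' hy' => ?_
    rw [(dual y').2.1]
    exact le_iInf₂ fun l' hl' =>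
      (weak y l hl).trans (isMinOn_iff.1 hmin (y', l') (mk_mem_prod hy' hl'))
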